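/- Let $A$ and $B$ be irreducible square matrices with entries in $\{0,1\}$, of sizes $N,M\ge 2$, satisfying condition (I) of Cuntz and Krieger: from every index there is an admissible path to an index $j$ at which at least two distinct first-return loops are based (i.e. distinct admissible words that begin and end with $j$, have length at least $2$, and have no $j$ in between). Let $X_A=\{(x_n)_{n\ge1}\in\{1,\dots,N\}^{\mathbb N} : A(x_n,x_{n+1})=1 \text{ for all } n\}$ with the product topology and the shift $\sigma_A((x_n)_n)=(x_{n+1})_n$, and write $orb_{\sigma_A}(x)=\bigcup_{k,l\ge0}\sigma_A^{-k}(\sigma_A^l(x))$; similarly for $B$. Let $h:X_A\to X_B$ be a homeomorphism giving rise to a continuous orbit equivalence, i.e. $h(orb_{\sigma_A}(x))=orb_{\sigma_B}(h(x))$ for all $x\in X_A$, and let $k_1,l_1:X_A\to\mathbb Z_{\ge0}$ and $k_2,l_2:X_B\to\mathbb Z_{\ge0}$ be continuous functions with $$\sigma_B^{k_1(x)}(h(\sigma_A(x)))=\sigma_B^{l_1(x)}(h(x)),\quad x\in X_A,\qquad \sigma_A^{k_2(y)}(h^{-1}(\sigma_B(y)))=\sigma_A^{l_2(y)}(h^{-1}(y)),\quad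 y\in X_B.$$ For $f\in C(X_B,\mathbb Z)$ and $g\in C(X_A,\mathbb Z)$ put $$\Psi_h(f)(x)=\sum_{i=0}^{l_1(x)-1}f(\sigma_B^i(h(x)))-\sum_{j=0}^{k_1(x)-1}f(\sigma_B^j(h(\sigma_A(x)))),\quad x\in X_A,$$ $$\Psi_{h^{-1}}(g)(y)=\sum_{i=0}^{l_2(y)-1}g(\sigma_A^i(h^{-1}(y)))-\sum_{j=0}^{k_2(y)-1}g(\sigma_A^j(h^{-1}(\sigma_B(y)))),\quad y\in X_B.$$ Let $H^A=C(X_A,\mathbb Z)/\{\xi-\xi\circ\sigma_A : \xi\in C(X_A,\mathbb Z)\}$, with positive cone $H^A_+=\{[\xi]\in H^A : \xi(x)\ge0 \text{ for all } x\in X_A\}$, and define $(H^B,H^B_+)$ similarly. Then $\Psi_h:C(X_B,\mathbb Z)\to C(X_A,\mathbb Z)$ and $\Psi_{h^{-1}}:C(X_A,\mathbb Z)\to C(X_B,\mathbb Z)$ are group isomorphisms inverse to each other such that (i) $\Psi_h(1_B)(x)=l_1(x)-k_1(x)$ for $x\in X_A$, where $1_B$ is the constant function $1$ on $X_B$; (ii)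 $\Psi_{h^{-1}}(1_A)(y)=l_2(y)-k_2(y)$ for $y\in X_B$, where $1_A$ is the constant function $1$ on $X_A$; (iii) $[\Psi_h(f)]\in H^A_+$ whenever $f\in C(X_B,\mathbb Z)$ and $[f]\in H^B_+$; (iv) $[\Psi_{h^{-1}}(g)]\in H^B_+$ whenever $g\in C(X_A,\mathbb Z)$ and $[g]\in H^A_+$. Consequently $\Psi_h$ induces an isomorphism $\bar\Psi_h:(H^B,H^B_+)\to(H^A,H^A_+)$ of the ordered cohomology groups: a group isomorphism $\bar\Psi_h:H^B\to H^A$ with $\bar\Psi_h([f])=[\Psi_h(f)]$ for all $f\in C(X_B,\mathbb Z)$, $\bar\Psi_h^{-1}([g])=[\Psi_{h^{-1}}(g)]$ for all $g\in C(X_A,\mathbb Z)$, and $\bar\Psi_h(H^B_+)=H^A_+$. -/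

import Mathlib

/-- A square matrix with entries in `{0, 1}`. -/
def IsZeroOne {N : ℕ} (A : Matrix (Fin N) (Fin N) ℤ) : Prop :=
  ∀ i j, A i j = 0 ∨ A i j = 1

/-- `w` is the interior of a first-return loop at `i`: the word `i w i` is admissible
and `i` does not occur in `w`. -/
def IsFirstReturn {N : ℕ} (A : Matrix (Fin N) (Fin N) ℤ) (i : Fin N) (w : List (Fin N)) : Prop :=
  i ∉ w ∧ List.IsChain (fun a b => A a b = 1) (i :: (w ++ [i]))

/-- Condition (I) of Cuntz and Krieger: from every index `i` there is an admissible path to an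
index `j` at which two distinct first-return loops are based. -/
def ConditionI {N : ℕ} (A : Matrix (Fin N) (Fin N) ℤ) : Prop :=
  ∀ i, ∃ j, Relation.ReflTransGen (fun a b => A a b = 1) i j ∧
    ∃ u v : List (Fin N), u ≠ v ∧ IsFirstReturn A j u ∧ IsFirstReturn A j v

/-- The one-sided shift space `X_A`, with the topology induced from the product topology on
`ℕ → Fin N` (`Fin N` being discrete). Coordinates are numbered from `0`. -/
abbrev ShiftSpace {N : ℕ} (A : Matrix (Fin N) (Fin N) ℤ) : Type :=
  {x : ℕ → Fin N // ∀ n, A (x n) (x (n + 1)) = 1}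

/-- The shift `σ_A : X_A → X_A`, `(x_n)_n ↦ (x_{n+1})_n`. -/
def shift {N : ℕ} (A : Matrix (Fin N) (Fin N) ℤ) : C(ShiftSpace A, ShiftSpace A) where
  toFun x := ⟨fun n => x.1 (n + 1), fun n => x.2 (n + 1)⟩
  continuous_toFun := by
    refine Continuous.subtype_mk (continuous_pi fun n => ?_) _
    exact (continuous_apply (A := fun _ : ℕ => Fin N) (n + 1)).comp continuous_subtype_val

/-- The orbit `⋃_{k, l ≥ 0} σ_A^{-k}(σ_A^l(x))`. -/
def shiftOrbit {N : ℕ} (A : Matrix (Fin N) (Fin N) ℤ) (x : ShiftSpace A) : Set (ShiftSpace A) :=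
  ⋃ (k : ℕ) (l : ℕ), (shift A)^[k] ⁻¹' {(shift A)^[l] x}

/-- The homeomorphism `h : X_A → X_B` gives rise to a continuous orbit equivalence, as witnessed by
the continuous functions `k₁, l₁ : X_A → ℤ_{≥0}` and `k₂, l₂ : X_B → ℤ_{≥0}`. -/
structure IsContinuousOrbitEquiv {N M : ℕ} (A : Matrix (Fin N) (Fin N) ℤ)
    (B : Matrix (Fin M) (Fin M) ℤ) (h : ShiftSpace A ≃ₜ ShiftSpace B)
    (k₁ l₁ : C(ShiftSpace A, ℕ)) (k₂ l₂ : C(ShiftSpace B, ℕ)) : Prop where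
  image_orbit : ∀ x, h '' shiftOrbit A x = shiftOrbit B (h x)
  eq_left : ∀ x, (shift B)^[k₁ x] (h (shift A x)) = (shift B)^[l₁ x] (h x)
  eq_right : ∀ y, (shift A)^[k₂ y] (h.symm (shift B y)) = (shift A)^[l₂ y] (h.symm y)

/-- A sum of continuous integer-valued functions with a continuously varying (hence locally
constant) number of terms is continuous. -/
lemma continuous_sum_range {X : Type*} [TopologicalSpace X] (l : C(X, ℕ)) (F : ℕ → X → ℤ)
    (hF : ∀ i, Continuous (F i)) : Continuous fun x => ∑ i ∈ Finset.range (l x), F i x := by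
  rw [continuous_iff_continuousAt]
  intro x
  have hl : ∀ᶠ y in nhds x, l y = l x :=
    
    l.continuous.continuousAt.eventually (p := fun m => m = l x) (by simp [nhds_discrete])
  have hc : ContinuousAt (fun y => ∑ i ∈ Finset.range (l x), F i y) x :=
    (continuous_finsetSum _ fun i _ => hF i).continuousAt
  refine hc.congr ?_
  filter_upwards [hl] with y hy
  rw [hy]

/-- The homomorphism `Ψ_h : C(X_B, ℤ) → C(X_A, ℤ)`,
`Ψ_h(f)(x) = ∑_{i < l(x)} f(σ_B^i(h(x))) - ∑_{j < k(x)} f(σ_B^j(h(σ_A(x))))`.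
For the map `Ψ_{h⁻¹}`, apply it to `h⁻¹` with `A`, `B` exchanged. -/
def Psi {N M : ℕ} {A : Matrix (Fin N) (Fin N) ℤ} {B : Matrix (Fin M) (Fin M) ℤ}
    (h : ShiftSpace A ≃ₜ ShiftSpace B) (k l : C(ShiftSpace A, ℕ)) :
    C(ShiftSpace B, ℤ) →+ C(ShiftSpace A, ℤ) where
  toFun f :=
    { toFun := fun x => ∑ i ∈ Finset.range (l x), f ((shift B)^[i] (h x)) -
        ∑ j ∈ Finset.range (k x), f ((shift B)^[j] (h (shift A x)))
      continuous_toFun :=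
        (continuous_sum_range l (fun i x => f ((shift B)^[i] (h x))) fun i =>
          f.continuous.comp (((shift B).continuous.iterate i).comp h.continuous)).sub
        (continuous_sum_range k (fun j x => f ((shift B)^[j] (h (shift A x)))) fun j =>
          f.continuous.comp (((shift B).continuous.iterate j).comp
            (h.continuous.comp (shift A).continuous))) }
  map_zero' := by ext x; simp
  map_add' f g := by
    ext x
    simp only [ContinuousMap.coe_mk, ContinuousMap.add_apply, Finset.sum_add_distrib]
    ring

/-- The subgroup of coboundaries `ξ - ξ ∘ σ_A`, `ξ ∈ C(X_A, ℤ)`. -/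
def coboundaries {N : ℕ} (A : Matrix (Fin N) (Fin N) ℤ) : AddSubgroup C(ShiftSpace A, ℤ) where
  carrier := {f | ∃ ξ : C(ShiftSpace A, ℤ), f = ξ - ξ.comp (shift A)}
  zero_mem' := ⟨0, by ext x; simp⟩
  add_mem' := by
    rintro _ _ ⟨ξ, rfl⟩ ⟨η, rfl⟩
    refine ⟨ξ + η, ?_⟩
    ext x
    simp only [ContinuousMap.add_apply, ContinuousMap.sub_apply, ContinuousMap.comp_apply]
    ring
  neg_mem' := by
    rintro _ ⟨ξ, rfl⟩
    refine ⟨-ξ, ?_⟩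
    ext x
    simp only [ContinuousMap.neg_apply, ContinuousMap.sub_apply, ContinuousMap.comp_apply]
    ring

/-- The cohomology group `H^A = C(X_A, ℤ) / {ξ - ξ ∘ σ_A}`. -/
abbrev Cohomology {N : ℕ} (A : Matrix (Fin N) (Fin N) ℤ) : Type :=
  C(ShiftSpace A, ℤ) ⧸ coboundaries A

/-- The class `[f] ∈ H^A` of `f ∈ C(X_A, ℤ)`. -/
def cohomologyClass {N : ℕ} (A : Matrix (Fin N) (Fin N) ℤ) :
    C(ShiftSpace A, ℤ) →+ Cohomology A :=
  QuotientAddGroup.mk' (coboundaries A)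

/-- The positive cone `H^A_+`: the classes of nonnegative functions. -/
def positiveCone {N : ℕ} (A : Matrix (Fin N) (Fin N) ℤ) : AddSubmonoid (Cohomology A) where
  carrier := {u | ∃ f : C(ShiftSpace A, ℤ), (∀ x, 0 ≤ f x) ∧ cohomologyClass A f = u}
  zero_mem' := ⟨0, fun _ => le_rfl, map_zero _⟩
  add_mem' := by
    rintro _ _ ⟨f, hf, rfl⟩ ⟨g, hg, rfl⟩
    exact ⟨f + g, fun x => add_nonneg (hf x) (hg x), map_add _ _ _⟩

/-! Write `a` and `b` for the Birkhoff sums of `l` and `k` over `p` steps at `x`. Iterating the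
relation gives `σ_B^a (h x) = σ_B^b (h (σ_A^p x))`, and `Ψ_h f` summed over `p` steps is the
difference of the sums of `f` along these two segments (`birkhoffSum_psi`).

Inverses: expanding `Ψ_{h⁻¹} (Ψ_h f) y` this way leaves `f y` whenever `y` is not eventually
periodic, since the lengths of the segments are then forced to match. Condition (I) excludes
isolated points, so by Baire such `y` are dense, and continuity finishes.

Positivity: at a point of period `p` the two segments have the same start, so the sum of `Ψ_h f` is
nonnegative for `f ≥ 0` once `b ≤ a` (`birkhoffSum_le_of_periodic`). A Livšic-type argument
(`cohomologyClass_mem_positiveCone_of_periodic`) turns nonnegative periodic sums into a nonnegative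
representative. Coboundaries go to coboundaries by telescoping, so everything descends to
cohomology. -/

open Filter Topology

/-! ### Topology of the shift space and surgery on its points. -/

namespace ShiftSpace

variable {N : ℕ} {A : Matrix (Fin N) (Fin N) ℤ}

lemma shift_iterate_apply (n : ℕ) (x : ShiftSpace A) (i : ℕ) :
    ((shift A)^[n] x).1 i = x.1 (i + n) := by
  induction n generalizing x with
  | zero => rfl
  | succ n ih =>
    rw [Function.iterate_succ_apply, ih]
    exact congrArg x.1 (by omega)

instance : CompactSpace (ShiftSpace A) := by
  refine isCompact_iff_compactSpace.1 (IsClosed.isCompact ?_)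
  have : {x : ℕ → Fin N | ∀ n, A (x n) (x (n + 1)) = 1} =
      ⋂ n, {x : ℕ → Fin N | A (x n) (x (n + 1)) = 1} := by
    ext
    simp
  change IsClosed {x : ℕ → Fin N | ∀ n, A (x n) (x (n + 1)) = 1}
  rw [this]
  refine isClosed_iInter fun n => ?_
  have hc : Continuous fun x : ℕ → Fin N => (x n, x (n + 1)) :=
    (continuous_apply n).prodMk (continuous_apply (n + 1))
  exact (isClosed_discrete {p : Fin N × Fin N | A p.1 p.2 = 1}).preimage hc

/-- The cylinder sets at `x` form a neighbourhood basis of `x`. -/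
lemma eventually_nhds_iff {x : ShiftSpace A} {p : ShiftSpace A → Prop} :
    (∀ᶠ z in 𝓝 x, p z) ↔ ∃ n, ∀ z : ShiftSpace A, (∀ i < n, z.1 i = x.1 i) → p z := by
  constructor
  · intro hp
    rw [nhds_subtype_eq_comap, eventually_comap] at hp
    obtain ⟨v, ⟨y, n, rfl⟩, hxv, hv⟩ :=
      (PiNat.isTopologicalBasis_cylinders fun _ : ℕ => Fin N).mem_nhds_iff.1 hp
    refine ⟨n, fun z hz => hv (a := z.1) (fun i hi => ?_) z rfl⟩
    rw [hz i hi, hxv i hi]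
  · rintro ⟨n, hn⟩
    have ho : IsOpen (PiNat.cylinder x.1 n) := PiNat.isOpen_cylinder _ _ _
    filter_upwards [(ho.preimage continuous_subtype_val).mem_nhds (PiNat.self_mem_cylinder x.1 n)]
      with z hz
    exact hn z hz

/-- A continuous function to a discrete space is determined by finitely many coordinates. -/
lemma exists_forall_agree_imp_eq {T : Type*} [TopologicalSpace T] [DiscreteTopology T]
    (f : C(ShiftSpace A, T)) :
    ∃ n, ∀ x y : ShiftSpace A, (∀ i < n, x.1 i = y.1 i) → f x = f y := by
  have key (x : ShiftSpace A) :
      ∃ n, ∀ z : ShiftSpace A, (∀ i < n, z.1 i = x.1 i) → f z = f x :=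
    eventually_nhds_iff.1 (f.continuous.continuousAt.eventually (p := fun m => m = f x)
      (by simp [nhds_discrete]))
  choose n hn using key
  obtain ⟨t, -, ht⟩ := isCompact_univ.elim_nhds_subcover
    (fun x : ShiftSpace A => {z : ShiftSpace A | ∀ i < n x, z.1 i = x.1 i})
    fun x _ => eventually_nhds_iff.2 ⟨n x, fun _ hz => hz⟩
  refine ⟨t.sup n, fun x y hxy => ?_⟩
  obtain ⟨c, hc, hxc⟩ := Set.mem_iUnion₂.1 (ht (Set.mem_univ x))
  rw [hn c x hxc, hn c y fun i hi => ?_]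
  rw [← hxy i (hi.trans_le (Finset.le_sup hc)), hxc i hi]

/-- The point obtained from `z` by prepending the first `p` letters of `x`. -/
def prepend (x : ShiftSpace A) (p : ℕ) (z : ShiftSpace A) (hz : z.1 0 = x.1 p) :
    ShiftSpace A :=
  ⟨fun i => if i < p then x.1 i else z.1 (i - p), fun n => by
    rcases lt_trichotomy (n + 1) p with h | h | h
    · simpa [h, (Nat.lt_succ_self n).trans h] using x.2 n
    · subst h
      simpa [hz] using x.2 n
    · have h₁ := z.2 (n - p)
      change A (ite _ _ _) (ite _ _ _) = 1
      rwa [if_neg (show ¬ n < p by omega), if_neg (show ¬ n + 1 < p by omega),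
        show n + 1 - p = n - p + 1 by omega]⟩

lemma prepend_apply_of_lt {x : ShiftSpace A} {p : ℕ} {z : ShiftSpace A} (hz : z.1 0 = x.1 p)
    {i : ℕ} (hi : i < p) : (prepend x p z hz).1 i = x.1 i :=
  if_pos hi

lemma prepend_apply_add {x : ShiftSpace A} {p : ℕ} {z : ShiftSpace A} (hz : z.1 0 = x.1 p)
    (i : ℕ) : (prepend x p z hz).1 (p + i) = z.1 i := by
  simp [prepend]

lemma prepend_apply_of_le {x : ShiftSpace A} {p : ℕ} {z : ShiftSpace A} (hz : z.1 0 = x.1 p)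
    {i : ℕ} (hi : i ≤ p) : (prepend x p z hz).1 i = x.1 i := by
  rcases hi.lt_or_eq with hi | rfl
  · exact prepend_apply_of_lt hz hi
  · rw [← hz, ← prepend_apply_add hz 0, add_zero]

lemma shift_iterate_prepend {x : ShiftSpace A} {p : ℕ} {z : ShiftSpace A} (hz : z.1 0 = x.1 p) :
    (shift A)^[p] (prepend x p z hz) = z := by
  ext i
  rw [shift_iterate_apply, add_comm, prepend_apply_add]

/-- The periodic point repeating the first `p` letters of `x`. -/
def periodize (x : ShiftSpace A) (p : ℕ) (hp : 0 < p) (hx : x.1 p = x.1 0) : ShiftSpace A :=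
  ⟨fun i => x.1 (i % p), fun n => by
    have h := x.2 (n % p)
    have hlt := Nat.mod_lt n hp
    change A (x.1 (n % p)) (x.1 ((n + 1) % p)) = 1
    rcases (Nat.succ_le_of_lt hlt).lt_or_eq with h' | h'
    · rwa [← Nat.mod_add_mod, Nat.mod_eq_of_lt h']
    · rw [show (n + 1) % p = 0 by rw [← Nat.mod_add_mod, ← Nat.succ_eq_add_one, h', Nat.mod_self],
        ← hx]
      rwa [← Nat.succ_eq_add_one, h'] at h⟩

lemma periodize_apply_of_lt {x : ShiftSpace A} {p : ℕ} (hp : 0 < p) (hx : x.1 p = x.1 0) {i : ℕ}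
    (hi : i < p) : (periodize x p hp hx).1 i = x.1 i :=
  congrArg x.1 (Nat.mod_eq_of_lt hi)

lemma shift_iterate_periodize {x : ShiftSpace A} {p : ℕ} (hp : 0 < p) (hx : x.1 p = x.1 0) :
    (shift A)^[p] (periodize x p hp hx) = periodize x p hp hx := by
  ext i
  rw [shift_iterate_apply]
  exact congrArg (fun j => (x.1 j : ℕ)) (Nat.add_mod_right i p)

lemma exists_apply_zero_eq (hN : 1 < N) (hA01 : IsZeroOne A) (hA : A.IsIrreducible) (s : Fin N) :
    ∃ x : ShiftSpace A, x.1 0 = s := by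
  have : Nontrivial (Fin N) := Fin.nontrivial_iff_two_le.2 hN
  have (i : Fin N) : ∃ j, A i j = 1 := by
    obtain ⟨j, hj⟩ := hA.exists_pos i
    exact ⟨j, (hA01 i j).resolve_left hj.ne'⟩
  choose g hg using this
  refine ⟨⟨fun n => g^[n] s, fun n => ?_⟩, rfl⟩
  change A (g^[n] s) (g^[n + 1] s) = 1
  rw [Function.iterate_succ_apply']
  exact hg _

/-- Prepending a letter. -/
lemma exists_cons {s : Fin N} {z : ShiftSpace A} (h : A s (z.1 0) = 1) :
    ∃ w : ShiftSpace A, w.1 0 = s ∧ shift A w = z := by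
  refine ⟨⟨fun n => Nat.casesOn n s z.1, fun n => ?_⟩, rfl, rfl⟩
  cases n with
  | zero => exact h
  | succ n => exact z.2 n

lemma exists_shift_iterate_eq {s t : Fin N}
    (h : Relation.ReflTransGen (fun a b => A a b = 1) s t) {z : ShiftSpace A} (hz : z.1 0 = t) :
    ∃ (w : ShiftSpace A) (q : ℕ), w.1 0 = s ∧ (shift A)^[q] w = z := by
  induction h using Relation.ReflTransGen.head_induction_on with
  | refl => exact ⟨z, 0, hz, rfl⟩
  | head hab _ ih =>
    obtain ⟨w, q, rfl, hw⟩ := ih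
    obtain ⟨v, hv, rfl⟩ := exists_cons hab
    exact ⟨v, q + 1, hv, hw⟩

lemma reflTransGen_of_isIrreducible (hA01 : IsZeroOne A) (hA : A.IsIrreducible) (s t : Fin N) :
    Relation.ReflTransGen (fun a b => A a b = 1) s t := by
  let : Quiver (Fin N) := A.toQuiver
  obtain ⟨p, -⟩ := hA.connected s t
  induction p with
  | nil => exact .refl
  | cons _ e ih => exact ih.tail ((hA01 _ _).resolve_left (ne_of_gt e.down))

/-- Without branching, the path leaving `j` is forced until it first meets `j` again. Hence
condition (I) yields a letter with two successors. -/
lemma eq_of_isFirstReturn_of_unique {j : Fin N}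
    (huniq : ∀ a b c, A a b = 1 → A a c = 1 → b = c) {u v : List (Fin N)}
    (hu : IsFirstReturn A j u) (hv : IsFirstReturn A j v) : u = v := by
  suffices H : ∀ (u v : List (Fin N)) (c : Fin N), j ∉ u → j ∉ v →
      List.IsChain (fun a b => A a b = 1) (c :: (u ++ [j])) →
      List.IsChain (fun a b => A a b = 1) (c :: (v ++ [j])) → u = v from
    H u v j hu.1 hv.1 hu.2 hv.2
  intro u
  induction u with
  | nil =>
    rintro (_ | ⟨d, v⟩) c _ hv hcu hcv
    · rfl
    · simp only [List.nil_append, List.cons_append, List.isChain_cons_cons] at hcu hcv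
      exact absurd (huniq _ _ _ hcu.1 hcv.1) fun h => hv (by simp [h])
  | cons e u ih =>
    rintro (_ | ⟨d, v⟩) c hu hv hcu hcv
    · simp only [List.nil_append, List.cons_append, List.isChain_cons_cons] at hcu hcv
      exact absurd (huniq _ _ _ hcv.1 hcu.1) fun h => hu (by simp [h])
    · simp only [List.cons_append, List.isChain_cons_cons] at hcu hcv
      obtain rfl := huniq _ _ _ hcu.1 hcv.1
      rw [ih v e (fun h => hu (by simp [h])) (fun h => hv (by simp [h])) hcu.2 hcv.2]

/-- Under condition (I), the shift space has no isolated points. -/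
lemma exists_ne_of_conditionI (hN : 1 < N) (hA01 : IsZeroOne A) (hA : A.IsIrreducible)
    (hI : ConditionI A) (x : ShiftSpace A) (n : ℕ) :
    ∃ z : ShiftSpace A, z ≠ x ∧ ∀ i < n, z.1 i = x.1 i := by
  obtain ⟨a, b, c, hb, hc, hbc⟩ : ∃ a b c, A a b = 1 ∧ A a c = 1 ∧ b ≠ c := by
    by_contra! H
    obtain ⟨j, -, u, v, huv, hu, hv⟩ := hI (x.1 0)
    exact huv (eq_of_isFirstReturn_of_unique H hu hv)
  obtain ⟨y, rfl⟩ := exists_apply_zero_eq hN hA01 hA b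
  obtain ⟨y', rfl⟩ := exists_apply_zero_eq hN hA01 hA c
  obtain ⟨v, hv, rfl⟩ := exists_cons hb
  obtain ⟨v', hv', rfl⟩ := exists_cons hc
  obtain ⟨w, q, hw, hwv⟩ :=
    exists_shift_iterate_eq (reflTransGen_of_isIrreducible hA01 hA (x.1 n) a) hv
  have hwq : v'.1 0 = w.1 q := by
    rw [hv', ← hv, ← hwv, shift_iterate_apply, zero_add]
  let w' := prepend w q v' hwq
  have hw' : w'.1 0 = x.1 n := by rw [prepend_apply_of_le hwq q.zero_le, hw]
  -- Both points follow `x` for `n` letters and travel to `a`, then branch to `b` and to `c`; at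
  -- most one of them is `x`.
  have hne : prepend x n w hw ≠ prepend x n w' hw' := by
    intro h
    apply hbc
    have h1 := congrArg (shift A)^[n] h
    rw [shift_iterate_prepend, shift_iterate_prepend] at h1
    have h2 := congrArg (shift A)^[q] h1
    rw [shift_iterate_prepend, hwv] at h2
    rw [h2]
  by_cases h : prepend x n w hw = x
  · exact ⟨prepend x n w' hw', fun h' => hne (h.trans h'.symm),
      fun i hi => prepend_apply_of_lt _ hi⟩
  · exact ⟨_, h, fun i hi => prepend_apply_of_lt _ hi⟩

/-- Without isolated points, the points which are not eventually periodic are dense. -/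
lemma dense_not_eventually_periodic
    (hA : ∀ (x : ShiftSpace A) (n : ℕ), ∃ z : ShiftSpace A, z ≠ x ∧ ∀ i < n, z.1 i = x.1 i) :
    Dense {x : ShiftSpace A | ∀ m n : ℕ, (shift A)^[m] x = (shift A)^[n] x → m = n} := by
  have hsub : (⋂ p : {p : ℕ × ℕ // p.1 < p.2},
      {x : ShiftSpace A | (shift A)^[p.1.1] x = (shift A)^[p.1.2] x}ᶜ) ⊆
      {x : ShiftSpace A | ∀ m n : ℕ, (shift A)^[m] x = (shift A)^[n] x → m = n} := by
    intro x hx m n hmn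
    rw [Set.mem_iInter] at hx
    rcases lt_trichotomy m n with h | h | h
    · exact absurd hmn (hx ⟨(m, n), h⟩)
    · exact h
    · exact absurd hmn.symm (hx ⟨(n, m), h⟩)
  -- Baire category theorem on the compact Hausdorff space `X_A`.
  refine Dense.mono hsub (dense_iInter_of_isOpen (fun p => ?_) fun p => ?_)
  · exact (isClosed_eq ((shift A).continuous.iterate _)
      ((shift A).continuous.iterate _)).isOpen_compl
  · obtain ⟨⟨m, n⟩, hmn : m < n⟩ := p
    rw [← interior_eq_empty_iff_dense_compl, Set.eq_empty_iff_forall_notMem]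
    intro x hx
    obtain ⟨r, hr⟩ := eventually_nhds_iff.1 (mem_interior_iff_mem_nhds.1 hx)
    obtain ⟨z, hzx, hz⟩ := hA x (max r n)
    have hx' := hr x fun _ _ => rfl
    have hz' := hr z fun i hi => hz i (hi.trans_le (le_max_left _ _))
    -- Both points satisfy `σ^m = σ^n` with `m < n`, so each coordinate from `n` on repeats an
    -- earlier one and the first `n` letters decide everything.
    refine hzx (Subtype.ext (funext fun i => ?_))
    induction i using Nat.strong_induction_on with
    | _ i ih =>
      rcases lt_or_ge i n with hi | hi
      · exact hz i (hi.trans_le (le_max_right _ _))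
      · have e1 := congrArg (fun w : ShiftSpace A => w.1 (i - n)) hx'
        have e2 := congrArg (fun w : ShiftSpace A => w.1 (i - n)) hz'
        simp only [shift_iterate_apply, Nat.sub_add_cancel hi] at e1 e2
        rw [← e1, ← e2, ih _ (by omega)]

end ShiftSpace

/-! ### Cocycle identities for `Ψ`, and its sign on periodic orbits. -/

section Cocycle

variable {N M : ℕ} {A : Matrix (Fin N) (Fin N) ℤ} {B : Matrix (Fin M) (Fin M) ℤ}
  {h : ShiftSpace A ≃ₜ ShiftSpace B} {k l : C(ShiftSpace A, ℕ)}

lemma psi_apply (f : C(ShiftSpace B, ℤ)) (x : ShiftSpace A) :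
    Psi h k l f x = birkhoffSum (shift B) f (l x) (h x) -
      birkhoffSum (shift B) f (k x) (h (shift A x)) :=
  rfl

lemma psi_one_apply (x : ShiftSpace A) : Psi h k l 1 x = (l x : ℤ) - (k x : ℤ) := by
  simp [psi_apply, birkhoffSum]

/-- Iterating the relation between `h` and the shifts `p` times. -/
lemma shift_iterate_birkhoffSum
    (hkl : ∀ x, (shift B)^[k x] (h (shift A x)) = (shift B)^[l x] (h x))
    (p : ℕ) (x : ShiftSpace A) :
    (shift B)^[birkhoffSum (shift A) l p x] (h x) =
      (shift B)^[birkhoffSum (shift A) k p x] (h ((shift A)^[p] x)) := by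
  induction p with
  | zero => simp
  | succ p ih =>
    rw [birkhoffSum_succ, birkhoffSum_succ, add_comm, Function.iterate_add_apply, ih,
      ← Function.iterate_add_apply, add_comm, Function.iterate_add_apply, ← hkl,
      ← Function.iterate_add_apply, Function.iterate_succ_apply']

lemma birkhoffSum_psi
    (hkl : ∀ x, (shift B)^[k x] (h (shift A x)) = (shift B)^[l x] (h x))
    (f : C(ShiftSpace B, ℤ)) (p : ℕ) (x : ShiftSpace A) :
    birkhoffSum (shift A) (Psi h k l f) p x =
      birkhoffSum (shift B) f (birkhoffSum (shift A) l p x) (h x) -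
        birkhoffSum (shift B) f (birkhoffSum (shift A) k p x) (h ((shift A)^[p] x)) := by
  induction p with
  | zero => simp
  | succ p ih =>
    have e := shift_iterate_birkhoffSum hkl p x
    have e' := hkl ((shift A)^[p] x)
    rw [birkhoffSum_succ, ih, psi_apply, birkhoffSum_succ, birkhoffSum_succ,
      Function.iterate_succ_apply']
    set u := (shift A)^[p] x
    set a := birkhoffSum (shift A) l p x
    set b := birkhoffSum (shift A) k p x
    -- `e` and `e'` say where the orbit segments merge; past these points the sums run along common
    -- orbits and cancel.
    have h1 := birkhoffSum_add (shift B) f a (l u) (h x)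
    have h2 := birkhoffSum_add (shift B) f b (l u) (h u)
    have h3 := birkhoffSum_add (shift B) f (l u) b (h u)
    have h4 := birkhoffSum_add (shift B) f (k u) b (h (shift A u))
    rw [e] at h1
    rw [e'] at h4
    rw [add_comm] at h3
    rw [add_comm b (k u)]
    linarith

lemma psi_mem_coboundaries
    (hkl : ∀ x, (shift B)^[k x] (h (shift A x)) = (shift B)^[l x] (h x))
    {f : C(ShiftSpace B, ℤ)} (hf : f ∈ coboundaries B) : Psi h k l f ∈ coboundaries A := by
  obtain ⟨ξ, rfl⟩ := hf
  have tele (n : ℕ) (y : ShiftSpace B) :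
      birkhoffSum (shift B) (ξ - ξ.comp (shift B)) n y = ξ y - ξ ((shift B)^[n] y) := by
    induction n with
    | zero => simp
    | succ n ih =>
      rw [birkhoffSum_succ, ih, Function.iterate_succ_apply']
      simp
  refine ⟨ξ.comp h, ?_⟩
  ext x
  rw [psi_apply, tele, tele, hkl]
  simp

/-- The maps `Ψ` of a continuous orbit equivalence are mutually inverse. -/
lemma psi_symm_psi {k' l' : C(ShiftSpace B, ℕ)}
    (hkl : ∀ x, (shift B)^[k x] (h (shift A x)) = (shift B)^[l x] (h x))
    (hkl' : ∀ y, (shift A)^[k' y] (h.symm (shift B y)) = (shift A)^[l' y] (h.symm y))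
    (hB : Dense {y : ShiftSpace B | ∀ m n : ℕ, (shift B)^[m] y = (shift B)^[n] y → m = n})
    (f : C(ShiftSpace B, ℤ)) : Psi h.symm k' l' (Psi h k l f) = f := by
  refine ContinuousMap.coe_injective (Continuous.ext_on hB (ContinuousMap.continuous _)
    f.continuous fun y hy => ?_)
  rw [psi_apply, birkhoffSum_psi hkl, birkhoffSum_psi hkl, hkl']
  have e := shift_iterate_birkhoffSum hkl (l' y) (h.symm y)
  have e' := shift_iterate_birkhoffSum hkl (k' y) (h.symm (shift B y))
  rw [hkl'] at e'
  simp only [Homeomorph.apply_symm_apply] at e e' ⊢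
  set w := h ((shift A)^[l' y] (h.symm y))
  set a := birkhoffSum (shift A) l (l' y) (h.symm y)
  set b := birkhoffSum (shift A) k (l' y) (h.symm y)
  set a' := birkhoffSum (shift A) l (k' y) (h.symm (shift B y))
  set b' := birkhoffSum (shift A) k (k' y) (h.symm (shift B y))
  -- Both exponents carry `y` to `σ_B^(b + b') w`, so they agree by the choice of `y`.
  have hab : b' + a = b + a' + 1 := by
    apply hy
    rw [Function.iterate_add_apply, e, ← Function.iterate_add_apply, add_comm b',
      Function.iterate_add_apply, ← e', ← Function.iterate_add_apply, Function.iterate_succ_apply]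
  have h1 := birkhoffSum_add (shift B) f a b' y
  have h2 := birkhoffSum_add (shift B) f b b' w
  have h3 := birkhoffSum_add (shift B) f b' b w
  have h4 := birkhoffSum_add (shift B) f a' b (shift B y)
  have h5 := birkhoffSum_succ' (shift B) f (b + a') y
  rw [e] at h1
  rw [e'] at h4
  rw [add_comm, h2] at h3
  rw [add_comm, hab, h5, add_comm b a', h4] at h1
  linarith

/-- At a periodic point, `Ψ` has a nonnegative total cocycle. -/
lemma birkhoffSum_le_of_periodic
    (hA : ∀ (x : ShiftSpace A) (n : ℕ), ∃ z : ShiftSpace A, z ≠ x ∧ ∀ i < n, z.1 i = x.1 i)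
    (hkl : ∀ x, (shift B)^[k x] (h (shift A x)) = (shift B)^[l x] (h x))
    {p : ℕ} {x : ShiftSpace A} (hx : (shift A)^[p] x = x) :
    birkhoffSum (shift A) k p x ≤ birkhoffSum (shift A) l p x := by
  by_contra! hlt
  set a := birkhoffSum (shift A) l p x with ha
  set b := birkhoffSum (shift A) k p x with hb
  have hper (i : ℕ) : x.1 (i + p) = x.1 i := by
    rw [← ShiftSpace.shift_iterate_apply, hx]
  have hy : (shift B)^[a] (h x) = (shift B)^[b] (h x) := by
    have := shift_iterate_birkhoffSum hkl p x
    rwa [hx] at this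
  have hcont (m : C(ShiftSpace A, ℕ)) : Continuous (birkhoffSum (shift A) m p) :=
    continuous_finsetSum _ fun i _ => m.continuous.comp ((shift A).continuous.iterate i)
  have hev (m : C(ShiftSpace A, ℕ)) :
      ∀ᶠ z in 𝓝 x, birkhoffSum (shift A) m p z = birkhoffSum (shift A) m p x :=
    (hcont m).continuousAt.eventually (p := fun c => c = birkhoffSum (shift A) m p x)
      (by simp [nhds_discrete])
  have hevh : ∀ᶠ z in 𝓝 x, ∀ i < b, (h z).1 i = (h x).1 i :=
    h.continuous.continuousAt.eventually (ShiftSpace.eventually_nhds_iff.2 ⟨b, fun _ hz => hz⟩)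
  obtain ⟨r, hr⟩ := ShiftSpace.eventually_nhds_iff.1 ((hev k).and ((hev l).and hevh))
  -- `r + 1` rather than `r`: letter `0` must agree with that of `x` for the period of `x` to be
  -- prepended.
  obtain ⟨z₀, hz₀, hz₀x⟩ := hA x (r + 1)
  -- If `a < b`, then `h` is constant near `x`, contradicting injectivity. With `v` the point `z`
  -- preceded by one period of `x`, `σ_B^b (h z) = σ_B^a (h v)`: coordinate `j + b` of `h z` is
  -- coordinate `j + a` of `h v`, so each prepending gains at least one coordinate.
  have key (n : ℕ) : ∀ z : ShiftSpace A, (∀ i < r + 1, z.1 i = x.1 i) →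
      ∀ i < b + n, (h z).1 i = (h x).1 i := by
    induction n with
    | zero => exact fun z hz => (hr z fun i hi => hz i (by omega)).2.2
    | succ n ih =>
      intro z hz i hi
      have hzp : z.1 0 = x.1 p := by rw [hz 0 (by omega), ← hper 0, zero_add]
      have hv : ∀ i < r + 1, (ShiftSpace.prepend x p z hzp).1 i = x.1 i := by
        intro i hi
        rcases lt_or_ge i p with h | h
        · exact ShiftSpace.prepend_apply_of_lt hzp h
        · obtain ⟨j, rfl⟩ := Nat.exists_eq_add_of_le h
          rw [ShiftSpace.prepend_apply_add, hz j (by omega), add_comm, hper]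
      obtain ⟨hvk, hvl, -⟩ := hr _ fun i hi => hv i (by omega)
      have e := shift_iterate_birkhoffSum hkl p (ShiftSpace.prepend x p z hzp)
      rw [hvk, hvl, ShiftSpace.shift_iterate_prepend, ← ha, ← hb] at e
      rcases lt_or_ge i b with hib | hib
      · exact ih z hz i (by omega)
      · obtain ⟨j, rfl⟩ := Nat.exists_eq_add_of_le' hib
        rw [← ShiftSpace.shift_iterate_apply, ← ShiftSpace.shift_iterate_apply, ← e, ← hy,
          ShiftSpace.shift_iterate_apply, ShiftSpace.shift_iterate_apply]
        exact ih _ hv _ (by omega)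
  refine hz₀ (h.injective (Subtype.ext (funext fun i => ?_)))
  exact key (i + 1) z₀ hz₀x i (by omega)

lemma birkhoffSum_psi_nonneg
    (hA : ∀ (x : ShiftSpace A) (n : ℕ), ∃ z : ShiftSpace A, z ≠ x ∧ ∀ i < n, z.1 i = x.1 i)
    (hkl : ∀ x, (shift B)^[k x] (h (shift A x)) = (shift B)^[l x] (h x))
    {f : C(ShiftSpace B, ℤ)} (hf : ∀ y, 0 ≤ f y) {p : ℕ} {x : ShiftSpace A}
    (hx : (shift A)^[p] x = x) : 0 ≤ birkhoffSum (shift A) (Psi h k l f) p x := by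
  rw [birkhoffSum_psi hkl, hx, sub_nonneg]
  exact Finset.sum_le_sum_of_subset_of_nonneg
    (Finset.range_subset_range.2 (birkhoffSum_le_of_periodic hA hkl hx)) fun _ _ _ => hf _

end Cocycle

/-! ### Livšic-type positivity theorem. -/

section Livsic

variable {N : ℕ} {A : Matrix (Fin N) (Fin N) ℤ}

/-- If the sums of `f` along periodic orbits are nonnegative, all its Birkhoff sums are bounded
below: every finite word closes up to a periodic orbit by a path of bounded length. -/
lemma exists_le_birkhoffSum (hN : 1 < N) (hA01 : IsZeroOne A) (hA : A.IsIrreducible)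
    (f : C(ShiftSpace A, ℤ))
    (hf : ∀ (p : ℕ) (x : ShiftSpace A), (shift A)^[p] x = x → 0 ≤ birkhoffSum (shift A) f p x) :
    ∃ c : ℤ, ∀ (m : ℕ) (y : ShiftSpace A), c ≤ birkhoffSum (shift A) f m y := by
  obtain ⟨n, hn⟩ := ShiftSpace.exists_forall_agree_imp_eq f
  obtain ⟨C, hC⟩ : ∃ C : ℤ, ∀ x, f x ≤ C := by
    obtain ⟨C, hC⟩ := (isCompact_range f.continuous).bddAbove
    exact ⟨C, fun x => hC ⟨x, rfl⟩⟩
  have hpath (s t : Fin N) : ∃ (w : ShiftSpace A) (q : ℕ), w.1 0 = s ∧ w.1 q = t := by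
    obtain ⟨z, hz⟩ := ShiftSpace.exists_apply_zero_eq hN hA01 hA t
    obtain ⟨w, q, hw, rfl⟩ := ShiftSpace.exists_shift_iterate_eq
      (ShiftSpace.reflTransGen_of_isIrreducible hA01 hA s t) hz
    refine ⟨w, q, hw, ?_⟩
    rwa [ShiftSpace.shift_iterate_apply, zero_add] at hz
  choose w q hw hq using hpath
  let Q := Finset.univ.sup fun s : Fin N × Fin N => q s.1 s.2
  -- The periodic orbit has `m` steps whose `n`-letter windows lie in `y`, then at most `n + 1 + Q`
  -- others, each contributing at most `max C 0`. The `+ 1` keeps the period positive.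
  refine ⟨-((n + 1 + Q : ℕ) * max C 0), fun m y => ?_⟩
  let s := y.1 (m + (n + 1))
  let t := y.1 0
  have hqQ : q s t ≤ Q := Finset.le_sup (f := fun s : Fin N × Fin N => q s.1 s.2)
    (Finset.mem_univ (s, t))
  let v := ShiftSpace.prepend y (m + (n + 1)) (w s t) (hw s t)
  have hv : v.1 (m + (n + 1) + q s t) = v.1 0 := by
    rw [ShiftSpace.prepend_apply_add, hq, ShiftSpace.prepend_apply_of_lt _ (by omega)]
  let z := ShiftSpace.periodize v (m + (n + 1) + q s t) (by omega) hv
  have hz := hf _ z (ShiftSpace.shift_iterate_periodize _ hv)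
  have hzy (i : ℕ) (hi : i < m + (n + 1)) : z.1 i = y.1 i := by
    rw [ShiftSpace.periodize_apply_of_lt _ hv (by omega), ShiftSpace.prepend_apply_of_lt _ hi]
  have e : birkhoffSum (shift A) f m z = birkhoffSum (shift A) f m y := by
    refine Finset.sum_congr rfl fun i hi => hn _ _ fun j hj => ?_
    rw [Finset.mem_range] at hi
    rw [ShiftSpace.shift_iterate_apply, ShiftSpace.shift_iterate_apply, hzy _ (by omega)]
  have e' : birkhoffSum (shift A) f (n + 1 + q s t) ((shift A)^[m] z) ≤
      (n + 1 + Q : ℕ) * max C 0 := by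
    refine (Finset.sum_le_card_nsmul _ _ (max C 0)
      fun i _ => (hC _).trans (le_max_left _ _)).trans ?_
    rw [Finset.card_range, nsmul_eq_mul]
    exact mul_le_mul_of_nonneg_right (by exact_mod_cast (by omega)) (le_max_right _ _)
  rw [add_assoc, birkhoffSum_add, e] at hz
  linarith

/-- A function whose sums along periodic orbits are nonnegative is cohomologous to a nonnegative
function. -/
theorem cohomologyClass_mem_positiveCone_of_periodic (hN : 1 < N) (hA01 : IsZeroOne A)
    (hA : A.IsIrreducible) (f : C(ShiftSpace A, ℤ))
    (hf : ∀ (p : ℕ) (x : ShiftSpace A), (shift A)^[p] x = x → 0 ≤ birkhoffSum (shift A) f p x) :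
    cohomologyClass A f ∈ positiveCone A := by
  obtain ⟨c, hc⟩ := exists_le_birkhoffSum hN hA01 hA f hf
  obtain ⟨n, hn⟩ := ShiftSpace.exists_forall_agree_imp_eq f
  -- Sums of `f` along all finite pasts of `x`; their infimum is the transfer function.
  let S (x : ShiftSpace A) : Set ℤ :=
    {v | ∃ (m : ℕ) (y : ShiftSpace A), (shift A)^[m] y = x ∧ birkhoffSum (shift A) f m y = v}
  have hSne (x) : (S x).Nonempty := ⟨0, 0, x, rfl, birkhoffSum_zero _ _ _⟩
  have hSbdd (x) : BddBelow (S x) := ⟨c, by rintro _ ⟨m, y, -, rfl⟩; exact hc m y⟩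
  -- A past of `x` can be grafted onto `x'` without changing the sum, as `f` sees `n` letters; the
  -- `+ 1` secures the junction letter when `n = 0`.
  have hsub (x x' : ShiftSpace A) (hxx : ∀ i < n + 1, x'.1 i = x.1 i) : S x ⊆ S x' := by
    rintro _ ⟨m, y, rfl, rfl⟩
    have h0 : x'.1 0 = y.1 m := by
      rw [hxx 0 n.succ_pos, ShiftSpace.shift_iterate_apply, zero_add]
    refine ⟨m, ShiftSpace.prepend y m x' h0, ShiftSpace.shift_iterate_prepend h0,
      Finset.sum_congr rfl fun i hi => hn _ _ fun j hj => ?_⟩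
    rw [Finset.mem_range] at hi
    rw [ShiftSpace.shift_iterate_apply, ShiftSpace.shift_iterate_apply]
    rcases lt_or_ge (j + i) m with h | h
    · exact ShiftSpace.prepend_apply_of_lt h0 h
    · obtain ⟨d, hd⟩ := Nat.exists_eq_add_of_le h
      rw [hd, ShiftSpace.prepend_apply_add, hxx d (by omega), ShiftSpace.shift_iterate_apply,
        add_comm]
  let ξ : C(ShiftSpace A, ℤ) := ⟨fun x => sInf (S x), by
    refine continuous_iff_continuousAt.2 fun x => tendsto_nhds_of_eventually_eq ?_
    refine ShiftSpace.eventually_nhds_iff.2 ⟨n + 1, fun z hz => ?_⟩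
    exact congrArg sInf ((hsub z x fun i hi => (hz i hi).symm).antisymm (hsub x z hz))⟩
  refine ⟨f + (ξ - ξ.comp (shift A)), fun x => ?_, ?_⟩
  · obtain ⟨m, y, hy, hv⟩ := Int.csInf_mem (hSne x) (hSbdd x)
    -- A minimizing past of `x`, extended by `x` itself, is a past of `σ_A x`.
    have hle : sInf (S (shift A x)) ≤ sInf (S x) + f x := by
      refine csInf_le (hSbdd _) ⟨m + 1, y, ?_, ?_⟩
      · rw [Function.iterate_succ_apply', hy]
      · rw [birkhoffSum_succ, hy, hv]
    change 0 ≤ f x + (sInf (S x) - sInf (S (shift A x)))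
    linarith
  · rw [map_add, add_eq_left]
    exact (QuotientAddGroup.eq_zero_iff _).2 ⟨ξ, rfl⟩

end Livsic

/-! ### Passage to the ordered cohomology groups. -/

section OrderedCohomology

variable {N M : ℕ} {A : Matrix (Fin N) (Fin N) ℤ} {B : Matrix (Fin M) (Fin M) ℤ}
  {h : ShiftSpace A ≃ₜ ShiftSpace B} {k l : C(ShiftSpace A, ℕ)}

lemma cohomologyClass_psi_mem_positiveCone (hN : 1 < N) (hA01 : IsZeroOne A)
    (hA : A.IsIrreducible) (hAI : ConditionI A)
    (hkl : ∀ x, (shift B)^[k x] (h (shift A x)) = (shift B)^[l x] (h x))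
    {f : C(ShiftSpace B, ℤ)} (hf : cohomologyClass B f ∈ positiveCone B) :
    cohomologyClass A (Psi h k l f) ∈ positiveCone A := by
  obtain ⟨g, hg, hgf⟩ := hf
  have hmem : Psi h k l (-g + f) ∈ coboundaries A :=
    psi_mem_coboundaries hkl (QuotientAddGroup.eq.1 hgf)
  rw [map_add, map_neg] at hmem
  have heq : cohomologyClass A (Psi h k l g) = cohomologyClass A (Psi h k l f) :=
    QuotientAddGroup.eq.2 hmem
  rw [← heq]
  exact cohomologyClass_mem_positiveCone_of_periodic hN hA01 hA _ fun p x hx =>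
    birkhoffSum_psi_nonneg (ShiftSpace.exists_ne_of_conditionI hN hA01 hA hAI) hkl hg hx

end OrderedCohomology

/-- The maps `Ψ_h` and `Ψ_{h⁻¹}` of a continuous orbit equivalence `h : X_A → X_B` are mutually
inverse isomorphisms, send `1` to the cocycle functions, preserve positive classes, and induce
an isomorphism of the ordered cohomology groups. -/
theorem mainTheorem1 {N M : ℕ} (hN : 1 < N) (hM : 1 < M)
    (A : Matrix (Fin N) (Fin N) ℤ) (B : Matrix (Fin M) (Fin M) ℤ)
    (hA01 : IsZeroOne A) (hB01 : IsZeroOne B)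
    (hAirr : A.IsIrreducible) (hBirr : B.IsIrreducible)
    (hAI : ConditionI A) (hBI : ConditionI B)
    (h : ShiftSpace A ≃ₜ ShiftSpace B)
    (k₁ l₁ : C(ShiftSpace A, ℕ)) (k₂ l₂ : C(ShiftSpace B, ℕ))
    (hcoe : IsContinuousOrbitEquiv A B h k₁ l₁ k₂ l₂) :
    -- `Ψ_h` and `Ψ_{h⁻¹}` are mutually inverse homomorphisms
    (∀ f, Psi h.symm k₂ l₂ (Psi h k₁ l₁ f) = f) ∧
    (∀ g, Psi h k₁ l₁ (Psi h.symm k₂ l₂ g) = g) ∧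
    -- the images of the constant functions `1`
    (∀ x, Psi h k₁ l₁ 1 x = (l₁ x : ℤ) - (k₁ x : ℤ)) ∧
    (∀ y, Psi h.symm k₂ l₂ 1 y = (l₂ y : ℤ) - (k₂ y : ℤ)) ∧
    -- both maps send positive classes to positive classes
    (∀ f, cohomologyClass B f ∈ positiveCone B →
      cohomologyClass A (Psi h k₁ l₁ f) ∈ positiveCone A) ∧
    (∀ g, cohomologyClass A g ∈ positiveCone A →
      cohomologyClass B (Psi h.symm k₂ l₂ g) ∈ positiveCone B) ∧
    -- the induced isomorphism of ordered groups
    ∃ Φ : Cohomology B ≃+ Cohomology A,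
      (∀ f, Φ (cohomologyClass B f) = cohomologyClass A (Psi h k₁ l₁ f)) ∧
      (∀ g, Φ.symm (cohomologyClass A g) = cohomologyClass B (Psi h.symm k₂ l₂ g)) ∧
      Φ '' (positiveCone B : Set (Cohomology B)) = (positiveCone A : Set (Cohomology A)) := by
  have hA := ShiftSpace.exists_ne_of_conditionI hN hA01 hAirr hAI
  have hB := ShiftSpace.exists_ne_of_conditionI hM hB01 hBirr hBI
  have hl := hcoe.eq_left
  have hr := hcoe.eq_right
  have inv₁ : ∀ f, Psi h.symm k₂ l₂ (Psi h k₁ l₁ f) = f :=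
    psi_symm_psi hl hr (ShiftSpace.dense_not_eventually_periodic hB)
  have inv₂ : ∀ g, Psi h k₁ l₁ (Psi h.symm k₂ l₂ g) = g :=
    psi_symm_psi (h := h.symm) hr hl (ShiftSpace.dense_not_eventually_periodic hA)
  have pos₁ : ∀ f, cohomologyClass B f ∈ positiveCone B →
      cohomologyClass A (Psi h k₁ l₁ f) ∈ positiveCone A := fun f =>
    cohomologyClass_psi_mem_positiveCone hN hA01 hAirr hAI hl
  have pos₂ : ∀ g, cohomologyClass A g ∈ positiveCone A →
      cohomologyClass B (Psi h.symm k₂ l₂ g) ∈ positiveCone B := fun g =>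
    cohomologyClass_psi_mem_positiveCone hM hB01 hBirr hBI hr
  let φ : Cohomology B →+ Cohomology A := QuotientAddGroup.map _ _ (Psi h k₁ l₁)
    fun _ hf => psi_mem_coboundaries hl hf
  let ψ : Cohomology A →+ Cohomology B := QuotientAddGroup.map _ _ (Psi h.symm k₂ l₂)
    fun _ hg => psi_mem_coboundaries hr hg
  have hφ (f) : φ (cohomologyClass B f) = cohomologyClass A (Psi h k₁ l₁ f) := rfl
  have hψ (g) : ψ (cohomologyClass A g) = cohomologyClass B (Psi h.symm k₂ l₂ g) := rfl
  have surjA := QuotientAddGroup.mk'_surjective (coboundaries A)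
  have surjB := QuotientAddGroup.mk'_surjective (coboundaries B)
  let Φ : Cohomology B ≃+ Cohomology A := AddEquiv.mk'
    ⟨φ, ψ, surjB.forall.2 fun f => congrArg (cohomologyClass B) (inv₁ f),
      surjA.forall.2 fun g => congrArg (cohomologyClass A) (inv₂ g)⟩ φ.map_add
  refine ⟨inv₁, inv₂, fun _ => psi_one_apply _, fun _ => psi_one_apply _, pos₁, pos₂,
    Φ, hφ, hψ, Set.Subset.antisymm ?_ ?_⟩
  · rintro _ ⟨u, hu, rfl⟩
    obtain ⟨f, rfl⟩ := surjB u
    exact pos₁ f hu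
  · intro u hu
    obtain ⟨g, rfl⟩ := surjA u
    exact ⟨_, pos₂ g hu, congrArg (cohomologyClass A) (inv₂ g)⟩
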